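/- Let $0<\alpha<1$, $0<\theta<1$ and $\Lambda>0$ be fixed, and set $\beta=\frac{2\alpha}{1-\alpha}$. Define the interval $I$ by $$I=[1-\theta,\,1-\Lambda\theta]\ \text{ if } 0<\Lambda<1,\qquad I=\Big[\frac{1-\theta}{\Lambda},\,1-\frac{\theta}{\Lambda}\Big]\ \text{ if } \Lambda>1,$$ and $I=\{1-\theta\}$ (the common value of both formulas) if $\Lambda=1$. Then $I\subset(0,1)$, and there exist $c>0$, $0<R<\infty$ and functions $u,v:[0,R]\to\mathbb R$ with $$u,v\in C^{\infty}([0,R))\cap C^{2+[\beta],\,\beta-[\beta]}([0,R]),\qquad v(0)\in I,\qquad v>0 \text{ on } [0,R),$$ which solve the one-phase free boundary problem $$u''-cu'=-v^{\alpha},\qquad \Lambda v''-cv'=v^{\alpha}\qquad\text{on } (0,R),$$ with the boundary conditions $$u(0)=\theta,\quad u'(0)=c\theta,\quad 0<v(0)<1,\quad v'(0)=-\frac{c}{\Lambda}\,(1-v(0)),$$ and the free boundary conditions $$v(R)=v'(R)=0,\quad u(R)=1,\quad u'(R)=0.$$ Here $[\beta]$ is the integer part of $\beta$, and $C^{k,\gamma}([0,R])$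 is the space of $k$ times continuously differentiable functions on $[0,R]$ whose $k$-th derivative is Hölder continuous with exponent $\gamma$ (simply $C^{k}([0,R])$ if $\gamma=0$); derivatives at the end points are one-sided. -/

import Mathlib

open Set
open scoped NNReal ContDiff

/-- `f` belongs to the Hölder space `C^{k,γ}([a,b])`: it is `k` times continuously differentiable
on the closed interval (one-sided derivatives at the end points) and its `k`-th derivative is
Hölder continuous on `[a,b]` with exponent `γ`. For `γ = 0` this is just `C^k([a,b])`. -/
def InHolderSpace (k : ℕ) (γ : ℝ≥0) (a b : ℝ) (f : ℝ → ℝ) : Prop :=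
  ContDiffOn ℝ (k : WithTop ℕ∞) f (Icc a b) ∧
    ∃ C : ℝ≥0, HolderOnWith C γ (iteratedDerivWithin k f (Icc a b)) (Icc a b)

/-- `(c, R, u, v)` solves the one-phase free boundary problem with reaction order `α`, ignition
temperature `θ` and inverse Lewis number `Λ`. Only the restrictions of `u` and `v` to `[0, R]`
matter; derivatives at `0` and at `R` are one-sided. -/
structure IsOnePhaseSolution (α θ Λ c R : ℝ) (u v : ℝ → ℝ) : Prop where
  c_pos : 0 < c
  R_pos : 0 < R
  u_smooth : ContDiffOn ℝ ∞ u (Ico 0 R)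
  v_smooth : ContDiffOn ℝ ∞ v (Ico 0 R)
  u_C1 : ContDiffOn ℝ 1 u (Icc 0 R)
  v_C1 : ContDiffOn ℝ 1 v (Icc 0 R)
  /-- The concentration is positive ahead of the free boundary, so that `v ^ α` is a genuine
  real power. -/
  v_pos : ∀ ξ ∈ Ico 0 R, 0 < v ξ
  u_eq : ∀ ξ ∈ Ioo 0 R, deriv (deriv u) ξ - c * deriv u ξ = -(v ξ ^ α)
  v_eq : ∀ ξ ∈ Ioo 0 R, Λ * deriv (deriv v) ξ - c * deriv v ξ = v ξ ^ α
  u_zero : u 0 = θ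
  u_deriv_zero : HasDerivWithinAt u (c * θ) (Icc 0 R) 0
  v_zero : 0 < v 0 ∧ v 0 < 1
  v_deriv_zero : HasDerivWithinAt v (-(c / Λ) * (1 - v 0)) (Icc 0 R) 0
  v_R : v R = 0
  v_deriv_R : HasDerivWithinAt v 0 (Icc 0 R) R
  u_R : u R = 1
  u_deriv_R : HasDerivWithinAt u 0 (Icc 0 R) R

/-- The interval `[1 - θ, 1 - Λθ]` for `Λ < 1` and `[(1 - θ)/Λ, 1 - θ/Λ]` for `Λ > 1`. For `Λ = 1`
both formulas give the single point `1 - θ`. -/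
noncomputable def initialInterval (θ Λ : ℝ) : Set ℝ :=
  if Λ < 1 then Icc (1 - θ) (1 - Λ * θ) else Icc ((1 - θ) / Λ) (1 - θ / Λ)

open Filter Topology

/-! Reverse and rescale by x = c(R - ξ). Both free boundary conditions become zero data at x = 0,
and v becomes a multiple of one profile V with ΛV'' + V' = V^α, independent of c and R. With P = ΛV'
and W = P + V the equation has the first integral W' = V^α. The temperature gradient becomes a
multiple of Q, where Q' = V^α - Q and Q(0) = 0, and u = 1 - (W - Q)/W(Y), v = V/W(Y), where x = Y
corresponds to ξ = 0. Dividing by W(Y) gives the flux condition on v, both conditions on u at ξ = 0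
reduce to the single equation Q(Y) = θW(Y), and c is fixed by c² W(Y)^(α-1) = 1.

The matching equation is solved by the intermediate value theorem: Q/W ≥ e^(-x), while Q/W ≤ W^(α-1)
→ 0 at infinity (`exists_matching`). The location of v(0) follows by comparing P and Q, which relax
to the same source V^α at rates 1/Λ and 1.

Since t^α is not Lipschitz at 0, the zero solution also satisfies the initial conditions. A
nontrivial V is obtained as the greatest fixed point of an integral operator below a supersolution,
kept positive by subsolutions (`exists_isProfile`).

For regularity put V = s^m with m = 2/(1-α) = 2 + β. In s and p = V'/s^(m-1) the derivatives of V
are s^(m-k) times smooth functions of (s, p), with s and p continuous up to 0 and s bounded below by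
a multiple of x. This gives smoothness for x > 0 and exactly m Hölder derivatives at 0; u inherits
them through a first-order linear equation. -/

/-- A profile of the problem in the variable `x = c (R - ξ)`: `Λ V'' + V' = V ^ α` written as a
first-order system for `V` and `P = Λ V'`, with zero data at the origin. -/
structure IsProfile (α Λ : ℝ) (V P : ℝ → ℝ) : Prop where
  hasDerivAt_V : ∀ x, HasDerivAt V (P x / Λ) x
  hasDerivAt_P : ∀ x, HasDerivAt P (V x ^ α - P x / Λ) x
  V_zero : V 0 = 0
  P_zero : P 0 = 0
  V_pos : ∀ x, 0 < x → 0 < V x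

open MeasureTheory ENNReal in
/-- The integral operator whose fixed points solve `Λ V'' + V' = V ^ α`, `V 0 = V' 0 = 0`. -/
noncomputable def profileOp (α Λ : ℝ) (f : ℝ → ℝ≥0∞) (x : ℝ) : ℝ≥0∞ :=
  ∫⁻ y in Ioo 0 x, ENNReal.ofReal (1 - Real.exp (-(x - y) / Λ)) * f y ^ α

/-! ### Existence of a nontrivial profile by monotone fixed points. -/

section Existence
open MeasureTheory ENNReal

lemma profileOp_mono {α Λ : ℝ} (hα0 : 0 < α) : Monotone (profileOp α Λ) := by
  intro f g hfg x
  refine lintegral_mono fun y => ?_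
  gcongr
  exact hfg y

lemma monotone_profileOp_apply {α Λ : ℝ} (hΛ : 0 < Λ) (f : ℝ → ℝ≥0∞) :
    Monotone (profileOp α Λ f) := by
  intro x x' hx
  refine lintegral_mono' (Measure.restrict_mono (Ioo_subset_Ioo_right hx) le_rfl) fun y => ?_
  dsimp only
  gcongr

/-- `A x ^ m` with `A ^ (1 - α) Λ = 1` is a supersolution. -/
lemma profileOp_super {α Λ m A : ℝ} (hα0 : 0 < α) (hΛ : 0 < Λ) (hm : 2 < m)
    (hmα : m * α = m - 2) (hA : 0 < A) (hAΛ : A ^ α / Λ = A) :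
    profileOp α Λ (fun x => ENNReal.ofReal (A * (max x 0) ^ m)) ≤
      fun x => ENNReal.ofReal (A * (max x 0) ^ m) := by
  intro x
  rcases le_or_gt x 0 with hx | hx
  · simp [profileOp, Ioo_eq_empty_of_le hx]
  have : ∀ y ∈ Ioo 0 x, ENNReal.ofReal (1 - Real.exp (-(x - y) / Λ)) *
      ENNReal.ofReal (A * (max y 0) ^ m) ^ α ≤ ENNReal.ofReal (x / Λ * (A ^ α * x ^ (m - 2))) := by
    intro y hy
    have hy0 : 0 < y := hy.1
    rw [max_eq_left hy0.le, ENNReal.ofReal_rpow_of_nonneg (by positivity) hα0.le,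
      Real.mul_rpow hA.le (by positivity), ← Real.rpow_mul hy0.le, hmα,
      ← ENNReal.ofReal_mul' (by positivity)]
    apply ENNReal.ofReal_le_ofReal
    have h1 : 1 - Real.exp (-(x - y) / Λ) ≤ x / Λ := by
      have := Real.add_one_le_exp (-(x - y) / Λ)
      have h2 : -(x - y) / Λ = y / Λ - x / Λ := by ring
      have h3 : 0 < y / Λ := by positivity
      linarith
    have h2 : y ^ (m - 2) ≤ x ^ (m - 2) := Real.rpow_le_rpow hy0.le hy.2.le (by linarith)
    gcongr
  calc profileOp α Λ _ x ≤ ∫⁻ y in Ioo 0 x, ENNReal.ofReal (x / Λ * (A ^ α * x ^ (m - 2))) :=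
        setLIntegral_mono measurable_const this
    _ = ENNReal.ofReal (A * (max x 0) ^ m) := by
        rw [setLIntegral_const, Real.volume_Ioo, ← ENNReal.ofReal_mul (by positivity),
          max_eq_left hx.le, sub_zero]
        congr 1
        have : x ^ m = x ^ (m - 2) * x * x := by
          rw [mul_assoc, ← pow_two, ← Real.rpow_natCast x 2, ← Real.rpow_add hx]
          norm_num
        rw [this]
        nth_rewrite 2 [← hAΛ]
        field_simp

/-- Small multiples of `x ^ m`, cut off at `X`, are subsolutions. -/
lemma profileOp_sub {α Λ m A : ℝ} (hα0 : 0 < α) (hα1 : α < 1) (hΛ : 0 < Λ)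
    (hmα : m * α = m - 2) (hA : 0 < A) {X : ℝ} (hX : 0 < X) :
    ∃ ε, 0 < ε ∧ ε ≤ A ∧
      (Ioc 0 X).indicator (fun x => ENNReal.ofReal (ε * x ^ m)) ≤
      profileOp α Λ ((Ioc 0 X).indicator (fun x => ENNReal.ofReal (ε * x ^ m))) := by
  -- On (x/4, x/2), of length x/4, the kernel is at least x/(2(Λ+X)) and y^(m-2) at least
  -- (x/4)^(m-2); the product of the three bounds is κ x^m. As α < 1, small ε satisfy ε ≤ κ ε^α.
  set κ : ℝ := (1 / 4 : ℝ) ^ (m - 2) / (8 * (Λ + X)) with hκ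
  have hκ0 : 0 < κ := by positivity
  obtain ⟨ε, hε0, hεA, hεκ⟩ : ∃ ε, 0 < ε ∧ ε ≤ A ∧ ε ≤ κ * ε ^ α := by
    have hne : 1 - α ≠ 0 := by linarith
    refine ⟨min A (κ ^ (1 / (1 - α))), lt_min hA (by positivity), min_le_left _ _, ?_⟩
    set ε := min A (κ ^ (1 / (1 - α)))
    have hε0 : 0 < ε := lt_min hA (by positivity)
    have h1 : ε ^ (1 - α) ≤ κ := by
      calc ε ^ (1 - α) ≤ (κ ^ (1 / (1 - α))) ^ (1 - α) :=
            Real.rpow_le_rpow hε0.le (min_le_right _ _) (by linarith)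
        _ = κ := by rw [← Real.rpow_mul hκ0.le]; field_simp; simp
    calc ε = ε ^ (1 - α) * ε ^ α := by rw [← Real.rpow_add hε0]; simp
      _ ≤ κ * ε ^ α := by gcongr
  refine ⟨ε, hε0, hεA, ?_⟩
  intro x
  by_cases hx : x ∈ Ioc 0 X
  swap
  · simp [hx]
  rw [indicator_of_mem hx]
  obtain ⟨hx0, hxX⟩ := hx
  have key : ∀ y ∈ Ioo (x / 4) (x / 2),
      ENNReal.ofReal (x / (2 * (Λ + X)) * (ε ^ α * (x * (1 / 4)) ^ (m - 2))) ≤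
      ENNReal.ofReal (1 - Real.exp (-(x - y) / Λ)) *
      (Ioc 0 X).indicator (fun x => ENNReal.ofReal (ε * x ^ m)) y ^ α := by
    intro y hy
    have hy0 : 0 < y := by linarith [hy.1]
    rw [indicator_of_mem (show y ∈ Ioc 0 X from ⟨hy0, by linarith [hy.2]⟩),
      ENNReal.ofReal_rpow_of_nonneg (by positivity) hα0.le,
      Real.mul_rpow hε0.le (by positivity), ← Real.rpow_mul hy0.le, hmα,
      ← ENNReal.ofReal_mul' (by positivity)]
    apply ENNReal.ofReal_le_ofReal
    have h1 : x / (2 * (Λ + X)) ≤ 1 - Real.exp (-(x - y) / Λ) := by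
      set t := (x - y) / Λ with ht
      have ht2 : x / (2 * Λ) ≤ t := by
        rw [ht, div_le_div_iff₀ (by positivity) hΛ]
        nlinarith [hy.2]
      have ht0 : 0 < t := lt_of_lt_of_le (by positivity) ht2
      have h2 : Real.exp (-(x - y) / Λ) ≤ 1 / (1 + t) := by
        rw [neg_div, ← ht, Real.exp_neg, ← one_div]
        apply one_div_le_one_div_of_le (by positivity)
        linarith [Real.add_one_le_exp t]
      have h3 : 1 / (1 + t) ≤ 1 / (1 + x / (2 * Λ)) := by
        apply one_div_le_one_div_of_le (by positivity); linarith
      have h4 : 1 - 1 / (1 + x / (2 * Λ)) = x / (2 * Λ + x) := by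
        field_simp; ring
      have h5 : x / (2 * (Λ + X)) ≤ x / (2 * Λ + x) := by
        apply div_le_div_of_nonneg_left hx0.le (by positivity); linarith
      linarith
    have h2 : (x * (1 / 4)) ^ (m - 2) ≤ y ^ (m - 2) := by
      apply Real.rpow_le_rpow (by positivity) (by linarith [hy.1])
      rw [← hmα]
      have : 0 < m * (1 - α) := by linarith
      have := pos_of_mul_pos_left this (by linarith)
      positivity
    exact mul_le_mul h1 (by gcongr) (by positivity)
      (le_trans (by positivity) h1)
  calc ENNReal.ofReal (ε * x ^ m)
      ≤ ENNReal.ofReal ((x / (2 * (Λ + X)) * (ε ^ α * (x * (1 / 4)) ^ (m - 2))) * (x / 4)) := by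
        apply ENNReal.ofReal_le_ofReal
        have : x ^ m = x ^ (m - 2) * x * x := by
          rw [mul_assoc, ← pow_two, ← Real.rpow_natCast x 2, ← Real.rpow_add hx0]
          norm_num
        rw [this, Real.mul_rpow hx0.le (by norm_num)]
        calc ε * (x ^ (m - 2) * x * x) ≤ (κ * ε ^ α) * (x ^ (m - 2) * x * x) := by gcongr
          _ = _ := by rw [hκ]; field_simp; ring
    _ = ∫⁻ y in Ioo (x / 4) (x / 2),
          ENNReal.ofReal (x / (2 * (Λ + X)) * (ε ^ α * (x * (1 / 4)) ^ (m - 2))) := by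
        rw [setLIntegral_const, Real.volume_Ioo, ← ENNReal.ofReal_mul (by positivity)]
        congr 2; ring
    _ ≤ ∫⁻ y in Ioo (x / 4) (x / 2), ENNReal.ofReal (1 - Real.exp (-(x - y) / Λ)) *
          (Ioc 0 X).indicator (fun x => ENNReal.ofReal (ε * x ^ m)) y ^ α :=
        setLIntegral_mono' measurableSet_Ioo key
    _ ≤ _ := lintegral_mono_set (Ioo_subset_Ioo (by linarith) (by linarith))

/-- A finite nontrivial fixed point of the integral operator, obtained from the lattice of
functions between zero and the supersolution. -/
lemma exists_profileOp_fixed {α Λ : ℝ} (hα0 : 0 < α) (hα1 : α < 1) (hΛ : 0 < Λ) :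
    ∃ f : ℝ → ℝ≥0∞, profileOp α Λ f = f ∧ (∀ x, f x ≠ ⊤) ∧ ∀ x, 0 < x → f x ≠ 0 := by
  have h1α : 0 < 1 - α := by linarith
  set m : ℝ := 2 / (1 - α) with hm
  have hm2 : 2 < m := by rw [hm, lt_div_iff₀ h1α]; linarith
  have hmα : m * α = m - 2 := by rw [hm]; field_simp; ring
  set A : ℝ := Λ ^ (-1 / (1 - α)) with hAdef
  have hA : 0 < A := by positivity
  have hAΛ : A ^ α / Λ = A := by
    rw [hAdef, ← Real.rpow_mul hΛ.le]
    nth_rewrite 2 [← Real.rpow_one Λ]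
    rw [← Real.rpow_sub hΛ]
    congr 1; field_simp; ring
  set B : ℝ → ℝ≥0∞ := fun x => ENNReal.ofReal (A * (max x 0) ^ m) with hB
  have hsuper : profileOp α Λ B ≤ B := profileOp_super hα0 hΛ hm2 hmα hA hAΛ
  -- Capping by `B` makes every fixed point finite; the supersolution property later shows that the
  -- cap is inactive. Values in [0, ∞] give a complete lattice in which no measurability has to be
  -- tracked.
  let F : (ℝ → ℝ≥0∞) →o (ℝ → ℝ≥0∞) :=
    ⟨fun f => B ⊓ profileOp α Λ f, fun f g h => inf_le_inf_left _ (profileOp_mono hα0 h)⟩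
  have hfix : B ⊓ profileOp α Λ F.gfp = F.gfp := F.map_gfp
  have hle : F.gfp ≤ B := hfix ▸ inf_le_left
  have hT : profileOp α Λ F.gfp ≤ B := (profileOp_mono hα0 hle).trans hsuper
  refine ⟨F.gfp, ?_, fun x => ?_, fun x hx => ?_⟩
  · rwa [inf_eq_right.2 hT] at hfix
  · exact ne_top_of_le_ne_top ENNReal.ofReal_ne_top (hle x)
  · obtain ⟨ε, hε, hεA, hsub⟩ := profileOp_sub (m := m) hα0 hα1 hΛ hmα hA hx
    have h1 : (Ioc 0 x).indicator (fun x => ENNReal.ofReal (ε * x ^ m)) ≤ F.gfp := by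
      refine F.le_gfp (le_inf (fun y => ?_) hsub)
      by_cases hy : y ∈ Ioc 0 x
      · have hy0 : 0 < y := hy.1
        rw [indicator_of_mem hy, hB]
        simp only [max_eq_left hy0.le]
        gcongr
      · simp [hy]
    have h2 := h1 x
    rw [indicator_of_mem (show x ∈ Ioc 0 x from ⟨hx, le_rfl⟩)] at h2
    have h3 : 0 < ENNReal.ofReal (ε * x ^ m) := ENNReal.ofReal_pos.2 (by positivity)
    exact (h3.trans_le h2).ne'

/-- The fixed point is monotone because the operator has monotone values, hence locally integrable;
the integral formula then makes it continuous, and then differentiable. It vanishes for x ≤ 0, so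
the equation holds on the whole line. -/
theorem exists_isProfile {α Λ : ℝ} (hα0 : 0 < α) (hα1 : α < 1) (hΛ : 0 < Λ) :
    ∃ V P : ℝ → ℝ, IsProfile α Λ V P := by
  obtain ⟨f, hf, hfin, hpos⟩ := exists_profileOp_fixed hα0 hα1 hΛ
  have hmono : Monotone f := hf ▸ monotone_profileOp_apply hΛ f
  set v : ℝ → ℝ := fun x => (f x).toReal with hv
  have hvf : ∀ x, ENNReal.ofReal (v x) = f x := fun x => ENNReal.ofReal_toReal (hfin x)
  have hv0 : ∀ x, 0 ≤ v x := fun x => ENNReal.toReal_nonneg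
  have hvmono : Monotone v := fun x y h => ENNReal.toReal_mono (hfin y) (hmono h)
  have hvneg : ∀ x ≤ 0, v x = 0 := by
    intro x hx
    rw [hv]; dsimp only; rw [← hf]; simp [profileOp, Ioo_eq_empty_of_le hx]
  set g : ℝ → ℝ := fun x => v x ^ α with hg
  have hg0 : ∀ x, 0 ≤ g x := fun x => Real.rpow_nonneg (hv0 x) _
  have hgmono : Monotone g := fun x y h => Real.rpow_le_rpow (hv0 x) (hvmono h) hα0.le
  have hgneg : ∀ x ≤ 0, g x = 0 := fun x hx => by
    simp [hg, hvneg x hx, Real.zero_rpow hα0.ne']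
  have hgi : ∀ a b, IntervalIntegrable g volume a b := fun a b => hgmono.intervalIntegrable
  have hegi : ∀ a b, IntervalIntegrable (fun y => Real.exp (y / Λ) * g y) volume a b :=
    fun a b => (hgi a b).continuousOn_mul (by fun_prop)
  -- Factoring the exponential kernel moves the dependence on x out of the integrals, leaving two
  -- primitives.
  have hrep : ∀ x, v x = (∫ y in (0:ℝ)..x, g y) -
      Real.exp (-x / Λ) * ∫ y in (0:ℝ)..x, Real.exp (y / Λ) * g y := by
    intro x
    rcases le_or_gt x 0 with hx | hx
    · have h1 : ∫ y in (0:ℝ)..x, g y = ∫ y in (0:ℝ)..x, (0:ℝ) := by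
        apply intervalIntegral.integral_congr
        intro y hy
        rw [uIcc_of_ge hx] at hy
        exact hgneg y hy.2
      have h2 : ∫ y in (0:ℝ)..x, Real.exp (y / Λ) * g y = ∫ y in (0:ℝ)..x, (0:ℝ) := by
        apply intervalIntegral.integral_congr
        intro y hy
        rw [uIcc_of_ge hx] at hy
        simp [hgneg y hy.2]
      rw [h1, h2, hvneg x hx]; simp
    · have hint : IntervalIntegrable (fun y => (1 - Real.exp (-(x - y) / Λ)) * g y) volume 0 x :=
        (hgi 0 x).continuousOn_mul (by fun_prop)
      have h1 : v x = ∫ y in (0:ℝ)..x, (1 - Real.exp (-(x - y) / Λ)) * g y := by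
        rw [intervalIntegral.integral_of_le hx.le, integral_Ioc_eq_integral_Ioo,
          integral_eq_lintegral_of_nonneg_ae]
        · change (f x).toReal = _
          conv_lhs => rw [← hf]
          congr 1
          refine setLIntegral_congr_fun measurableSet_Ioo fun y hy => ?_
          rw [ENNReal.ofReal_mul' (hg0 y), ← hvf y,
            ENNReal.ofReal_rpow_of_nonneg (hv0 y) hα0.le]
        · refine (ae_restrict_iff' measurableSet_Ioo).2 (Filter.Eventually.of_forall fun y hy => ?_)
          refine mul_nonneg (sub_nonneg.2 (Real.exp_le_one_iff.2 ?_)) (hg0 y)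
          exact div_nonpos_of_nonpos_of_nonneg (by linarith [hy.2]) hΛ.le
        · exact (hint.1.mono_set Ioo_subset_Ioc_self).aestronglyMeasurable
      rw [h1, ← intervalIntegral.integral_const_mul,
        ← intervalIntegral.integral_sub (hgi 0 x) ((hegi 0 x).const_mul _)]
      apply intervalIntegral.integral_congr
      intro y _
      dsimp only
      have : -(x - y) / Λ = -x / Λ + y / Λ := by ring
      rw [this, Real.exp_add]; ring
  have hvcont : Continuous v := by
    have h1 := intervalIntegral.continuous_primitive hgi 0
    have h2 := intervalIntegral.continuous_primitive hegi 0
    have h3 : v = fun x => (∫ y in (0:ℝ)..x, g y) -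
      Real.exp (-x / Λ) * ∫ y in (0:ℝ)..x, Real.exp (y / Λ) * g y := funext hrep
    rw [h3]
    exact h1.sub ((by fun_prop : Continuous fun x : ℝ => Real.exp (-x / Λ)).mul h2)
  have hgcont : Continuous g := hvcont.rpow_const fun x => Or.inr hα0.le
  have hd1 : ∀ x, HasDerivAt (fun x => ∫ y in (0:ℝ)..x, g y) (g x) x :=
    fun x => hgcont.integral_hasStrictDerivAt 0 x |>.hasDerivAt
  have hd2 : ∀ x, HasDerivAt (fun x => ∫ y in (0:ℝ)..x, Real.exp (y / Λ) * g y)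
      (Real.exp (x / Λ) * g x) x :=
    fun x => (by fun_prop : Continuous fun y => Real.exp (y / Λ) * g y).integral_hasStrictDerivAt
      0 x |>.hasDerivAt
  have hd3 : ∀ x, HasDerivAt (fun x : ℝ => Real.exp (-x / Λ)) (Real.exp (-x / Λ) * (-1 / Λ)) x :=
    fun x => ((hasDerivAt_neg x).div_const Λ).exp
  have hee : ∀ x, Real.exp (-x / Λ) * Real.exp (x / Λ) = 1 := fun x => by
    rw [← Real.exp_add, neg_div, neg_add_cancel, Real.exp_zero]
  set P : ℝ → ℝ := fun x => Real.exp (-x / Λ) * ∫ y in (0:ℝ)..x, Real.exp (y / Λ) * g y with hP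
  have hPd : ∀ x, HasDerivAt P (v x ^ α - P x / Λ) x := by
    intro x
    refine ((hd3 x).mul (hd2 x)).congr_deriv ?_
    simp only [hP, hg]
    linear_combination (v x ^ α) * hee x
  refine ⟨v, P, fun x => ?_, hPd, hvneg 0 le_rfl, by simp [hP],
    fun x hx => ENNReal.toReal_pos (hpos x hx) (hfin x)⟩
  have h3 : v = fun x => (∫ y in (0:ℝ)..x, g y) - P x := funext hrep
  rw [h3]
  refine ((hd1 x).sub (hPd x)).congr_deriv ?_
  simp only [hg]
  ring

end Existence

/-! ### Comparison principle and elementary properties of profiles. -/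

/-- If `D' + k D ≥ 0` on `[0, X]` and `D 0 ≥ 0` then `D X ≥ 0`. -/
lemma nonneg_of_hasDerivAt_add_mul_nonneg {D D' : ℝ → ℝ} {k X : ℝ} (hX : 0 ≤ X)
    (hD : ∀ x, HasDerivAt D (D' x) x) (h0 : 0 ≤ D 0)
    (h : ∀ x, 0 ≤ x → x ≤ X → 0 ≤ D' x + k * D x) : 0 ≤ D X := by
  have hd : ∀ x, HasDerivAt (fun x => Real.exp (k * x) * D x)
      (Real.exp (k * x) * (D' x + k * D x)) x := fun x => by
    refine ((((hasDerivAt_id x).const_mul k).exp).mul (hD x)).congr_deriv ?_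
    simp only [id]; ring
  have hmono : MonotoneOn (fun x => Real.exp (k * x) * D x) (Icc 0 X) := by
    refine monotoneOn_of_hasDerivWithinAt_nonneg (convex_Icc 0 X)
      (fun x _ => (hd x).continuousAt.continuousWithinAt)
      (fun x _ => (hd x).hasDerivWithinAt) fun x hx => ?_
    rw [interior_Icc] at hx
    exact mul_nonneg (Real.exp_pos _).le (h x hx.1.le hx.2.le)
  have := hmono ⟨le_rfl, hX⟩ ⟨hX, le_rfl⟩ hX
  simp only [mul_zero, Real.exp_zero, one_mul] at this
  exact nonneg_of_mul_nonneg_right (h0.trans this) (Real.exp_pos _)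

/-- The solution of `Q' = g - Q`, `Q 0 = 0`, exists for continuous `g`. -/
lemma exists_linear_solution {g : ℝ → ℝ} (hg : Continuous g) :
    ∃ Q : ℝ → ℝ, Q 0 = 0 ∧ ∀ x, HasDerivAt Q (g x - Q x) x := by
  refine ⟨fun x => Real.exp (-x) * ∫ y in (0:ℝ)..x, Real.exp y * g y, by simp, fun x => ?_⟩
  have h1 : HasDerivAt (fun x => ∫ y in (0:ℝ)..x, Real.exp y * g y) (Real.exp x * g x) x :=
    ((by fun_prop : Continuous fun y => Real.exp y * g y).integral_hasStrictDerivAt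
      0 x).hasDerivAt
  refine ((hasDerivAt_neg x).exp.mul h1).congr_deriv ?_
  have : Real.exp (-x) * Real.exp x = 1 := by rw [← Real.exp_add]; simp
  linear_combination g x * this

namespace IsProfile
variable {α Λ : ℝ} {V P : ℝ → ℝ}

lemma V_nonneg (h : IsProfile α Λ V P) {x : ℝ} (hx : 0 ≤ x) : 0 ≤ V x := by
  rcases hx.eq_or_lt with rfl | hx
  · exact h.V_zero.ge
  · exact (h.V_pos x hx).le

lemma P_nonneg (h : IsProfile α Λ V P) {x : ℝ} (hx : 0 ≤ x) : 0 ≤ P x := by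
  refine nonneg_of_hasDerivAt_add_mul_nonneg (k := 1 / Λ) hx h.hasDerivAt_P h.P_zero.ge
    fun y hy _ => ?_
  have := Real.rpow_nonneg (h.V_nonneg hy) α
  linarith [show P y / Λ = 1 / Λ * P y by ring]

lemma continuous_V (h : IsProfile α Λ V P) : Continuous V :=
  continuous_iff_continuousAt.2 fun x => (h.hasDerivAt_V x).continuousAt

lemma monotoneOn_V (h : IsProfile α Λ V P) (hΛ : 0 < Λ) : MonotoneOn V (Ici 0) := by
  refine monotoneOn_of_hasDerivWithinAt_nonneg (convex_Ici 0) h.continuous_V.continuousOn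
    (fun x _ => (h.hasDerivAt_V x).hasDerivWithinAt) fun x hx => ?_
  rw [interior_Ici] at hx
  exact div_nonneg (h.P_nonneg (le_of_lt hx)) hΛ.le

/-- The integrating factor e^(x/Λ) turns the equation for P into a strictly positive derivative.
Strictness is what makes p positive later. -/
lemma P_pos (h : IsProfile α Λ V P) {x : ℝ} (hx : 0 < x) : 0 < P x := by
  have hmono : StrictMonoOn (fun x => Real.exp (x / Λ) * P x) (Ici 0) := by
    have hd : ∀ x, HasDerivAt (fun x => Real.exp (x / Λ) * P x)
        (Real.exp (x / Λ) * V x ^ α) x := fun x => by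
      refine ((((hasDerivAt_id x).div_const Λ).exp).mul (h.hasDerivAt_P x)).congr_deriv ?_
      simp only [id]; ring
    refine strictMonoOn_of_deriv_pos (convex_Ici 0)
      (fun x _ => (hd x).continuousAt.continuousWithinAt) fun x hx => ?_
    rw [interior_Ici] at hx
    rw [(hd x).deriv]
    exact mul_pos (Real.exp_pos _) (Real.rpow_pos_of_pos (h.V_pos x hx) _)
  have := hmono (mem_Ici.2 le_rfl) (mem_Ici.2 hx.le) hx
  simp only [h.P_zero, mul_zero] at this
  exact pos_of_mul_pos_right this (Real.exp_pos _).le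

lemma rpow_mono (h : IsProfile α Λ V P) (hΛ : 0 < Λ) (hα : 0 < α) {x y : ℝ} (hx : 0 ≤ x)
    (hxy : x ≤ y) : V x ^ α ≤ V y ^ α :=
  Real.rpow_le_rpow (h.V_nonneg hx)
    (h.monotoneOn_V hΛ (mem_Ici.2 hx) (mem_Ici.2 (hx.trans hxy)) hxy) hα.le

lemma hasDerivAt_add (h : IsProfile α Λ V P) (x : ℝ) :
    HasDerivAt (fun x => P x + V x) (V x ^ α) x :=
  ((h.hasDerivAt_P x).add (h.hasDerivAt_V x)).congr_deriv (by ring)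

lemma add_pos (h : IsProfile α Λ V P) {x : ℝ} (hx : 0 < x) : 0 < P x + V x :=
  add_pos_of_nonneg_of_pos (h.P_nonneg hx.le) (h.V_pos x hx)

/-! ### The matching condition and the range of v(0). -/

section Transform
variable {Q : ℝ → ℝ} (hQ0 : Q 0 = 0) (hQ : ∀ x, HasDerivAt Q (V x ^ α - Q x) x)
include hQ0 hQ

lemma transform_le (h : IsProfile α Λ V P) (hΛ : 0 < Λ) (hα : 0 < α) {x : ℝ} (hx : 0 ≤ x) :
    Q x ≤ V x ^ α := by
  have := nonneg_of_hasDerivAt_add_mul_nonneg (D := fun y => V x ^ α - Q y) (k := 1) hx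
    (fun y => (hQ y).const_sub _) (by rw [hQ0, sub_zero]; exact Real.rpow_nonneg (h.V_nonneg hx) _)
    (fun y hy hyx => by linarith [h.rpow_mono hΛ hα hy hyx])
  linarith

lemma transform_nonneg (h : IsProfile α Λ V P) {x : ℝ} (hx : 0 ≤ x) : 0 ≤ Q x :=
  nonneg_of_hasDerivAt_add_mul_nonneg (k := 1) hx hQ hQ0.ge fun y hy _ => by
    linarith [Real.rpow_nonneg (h.V_nonneg hy) α]

/-- Here W is the integral of V^α, while Q is the same integral with weight e^(-(x-y)) ≥ e^(-x). -/
lemma le_transform (h : IsProfile α Λ V P) {x : ℝ} (hx : 0 ≤ x) :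
    Real.exp (-x) * (P x + V x) ≤ Q x := by
  have hd : ∀ y, HasDerivAt (fun y => Q y - Real.exp (-y) * (P y + V y))
      (V y ^ α - Q y - (Real.exp (-y) * (-1) * (P y + V y) + Real.exp (-y) * V y ^ α)) y :=
    fun y => (hQ y).sub ((hasDerivAt_neg y).exp.mul (h.hasDerivAt_add y))
  have := nonneg_of_hasDerivAt_add_mul_nonneg (k := 1) hx hd
    (by simp [hQ0, h.P_zero, h.V_zero]) fun y hy _ => by
      have h1 : Real.exp (-y) ≤ 1 := Real.exp_le_one_iff.2 (by linarith)
      have h2 := Real.rpow_nonneg (h.V_nonneg hy) α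
      nlinarith
  linarith

/-- The matching condition is attained at some point by the intermediate value theorem. -/
lemma exists_matching (h : IsProfile α Λ V P) (hΛ : 0 < Λ) (hα0 : 0 < α) (hα1 : α < 1)
    {θ : ℝ} (hθ0 : 0 < θ) (hθ1 : θ < 1) : ∃ Y, 0 < Y ∧ Q Y = θ * (P Y + V Y) := by
  have hlow : ∃ a, 0 < a ∧ θ ≤ Q a / (P a + V a) := by
    have h0 : 0 < -Real.log θ := by linarith [Real.log_neg hθ0 hθ1]
    refine ⟨-Real.log θ, h0, ?_⟩
    rw [le_div_iff₀ (h.add_pos h0)]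
    have := h.le_transform hQ0 hQ h0.le
    rwa [neg_neg, Real.exp_log hθ0] at this
  have hhigh : ∃ b, 0 < b ∧ Q b / (P b + V b) ≤ θ := by
    set g := V 1 ^ α with hg
    have hg0 : 0 < g := Real.rpow_pos_of_pos (h.V_pos 1 one_pos) _
    -- Chosen so that w^(α-1) = θ. Since W' ≥ g on [1, ∞), W reaches w by the time 1 + w/g.
    set w := θ ^ (1 / (α - 1)) with hw
    have hw0 : 0 < w := by positivity
    have hb : 0 < 1 + w / g := by positivity
    refine ⟨1 + w / g, hb, ?_⟩
    set b := 1 + w / g with hbdef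
    have hWb : w ≤ P b + V b := by
      have hmono : MonotoneOn (fun x => P x + V x - g * x) (Ici 1) := by
        have hd : ∀ x, HasDerivAt (fun x => P x + V x - g * x) (V x ^ α - g) x := fun x =>
          ((h.hasDerivAt_add x).sub ((hasDerivAt_id x).const_mul g)).congr_deriv (by ring)
        refine monotoneOn_of_hasDerivWithinAt_nonneg (convex_Ici 1)
          (fun x _ => (hd x).continuousAt.continuousWithinAt)
          (fun x _ => (hd x).hasDerivWithinAt) fun x hx => ?_
        rw [interior_Ici] at hx
        exact sub_nonneg.2 (h.rpow_mono hΛ hα0 zero_le_one (le_of_lt hx))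
      have h1b : 1 ≤ b := by rw [hbdef]; linarith [div_pos hw0 hg0]
      have := hmono (mem_Ici.2 le_rfl) (mem_Ici.2 h1b) h1b
      dsimp only at this
      have h2 : g * b = g + w := by rw [hbdef]; field_simp
      linarith [h.add_pos one_pos]
    have hW := h.add_pos hb
    have h1 : Q b ≤ (P b + V b) ^ α := (h.transform_le hQ0 hQ hΛ hα0 hb.le).trans
      (Real.rpow_le_rpow (h.V_nonneg hb.le) (by linarith [h.P_nonneg hb.le]) hα0.le)
    calc Q b / (P b + V b) ≤ (P b + V b) ^ α / (P b + V b) := by gcongr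
      _ = (P b + V b) ^ (α - 1) := by rw [Real.rpow_sub_one hW.ne']
      _ ≤ w ^ (α - 1) := Real.rpow_le_rpow_of_nonpos hw0 hWb (by linarith)
      _ = θ := by
        rw [hw, ← Real.rpow_mul hθ0.le, one_div_mul_cancel (by linarith), Real.rpow_one]
  obtain ⟨a, ha, haθ⟩ := hlow
  obtain ⟨b, hb, hbθ⟩ := hhigh
  have hcont : ContinuousOn (fun x => Q x / (P x + V x)) (Ioi 0) := fun x hx =>
    ((hQ x).continuousAt.div (h.hasDerivAt_add x).continuousAt
      (h.add_pos hx).ne').continuousWithinAt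
  obtain ⟨Y, hY, hYθ⟩ := isPreconnected_Ioi.intermediate_value (mem_Ioi.2 hb) (mem_Ioi.2 ha) hcont
    ⟨hbθ, haθ⟩
  refine ⟨Y, hY, ?_⟩
  dsimp only at hYθ
  rw [← hYθ, div_mul_cancel₀ _ (h.add_pos hY).ne']

/-- P and Q have the same source, and P is damped at least as fast when Λ ≤ 1. This and the next
three comparisons, evaluated at the matching point, are the four end point bounds for v(0) = V/W = 1
- P/W. -/
lemma P_le_transform (h : IsProfile α Λ V P) (hΛ : 0 < Λ) (hΛ1 : Λ ≤ 1) {x : ℝ} (hx : 0 ≤ x) :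
    P x ≤ Q x := by
  have := nonneg_of_hasDerivAt_add_mul_nonneg (k := 1) hx (fun y => (hQ y).sub (h.hasDerivAt_P y))
    (by simp [hQ0, h.P_zero]) fun y hy _ => by
      have h1 : P y ≤ P y / Λ := by
        rw [le_div_iff₀ hΛ]; exact mul_le_of_le_one_right (h.P_nonneg hy) hΛ1
      simp only [Pi.sub_apply]
      linarith
  simp only [Pi.sub_apply] at this
  linarith

lemma mul_transform_le_P (h : IsProfile α Λ V P) (hα : 0 < α) (hΛ : 0 < Λ) (hΛ1 : Λ ≤ 1)
    {x : ℝ} (hx : 0 ≤ x) : Λ * Q x ≤ P x := by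
  have := nonneg_of_hasDerivAt_add_mul_nonneg (k := 1 / Λ) hx
    (fun y => (h.hasDerivAt_P y).sub ((hQ y).const_mul Λ))
    (by simp [hQ0, h.P_zero]) fun y hy _ => by
      have h1 := h.transform_le hQ0 hQ hΛ hα hy
      simp only [Pi.sub_apply]
      have : V y ^ α - P y / Λ - Λ * (V y ^ α - Q y) + 1 / Λ * (P y - Λ * Q y) =
        (1 - Λ) * (V y ^ α - Q y) := by field_simp; ring
      rw [this]
      exact mul_nonneg (by linarith) (by linarith)
  simp only [Pi.sub_apply] at this
  linarith

lemma transform_div_le_P (h : IsProfile α Λ V P) (hΛ1 : 1 ≤ Λ)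
    {x : ℝ} (hx : 0 ≤ x) : Q x / Λ ≤ P x := by
  have hΛ : 0 < Λ := by linarith
  have := nonneg_of_hasDerivAt_add_mul_nonneg (k := 1 / Λ) hx
    (fun y => (h.hasDerivAt_P y).sub ((hQ y).div_const Λ))
    (by simp [hQ0, h.P_zero]) fun y hy _ => by
      have h1 := h.transform_nonneg hQ0 hQ hy
      have h2 := Real.rpow_nonneg (h.V_nonneg hy) α
      simp only [Pi.sub_apply]
      have : V y ^ α - P y / Λ - (V y ^ α - Q y) / Λ + 1 / Λ * (P y - Q y / Λ) =
        (1 - 1 / Λ) * (V y ^ α + Q y / Λ) := by field_simp; ring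
      rw [this]
      refine mul_nonneg ?_ (by positivity)
      rw [sub_nonneg, div_le_one hΛ]; exact hΛ1
  simp only [Pi.sub_apply] at this
  linarith

lemma add_sub_transform_le (h : IsProfile α Λ V P) (hΛ1 : 1 ≤ Λ)
    {x : ℝ} (hx : 0 ≤ x) : P x + V x - Q x ≤ Λ * V x := by
  have hΛ : 0 < Λ := by linarith
  have := nonneg_of_hasDerivAt_add_mul_nonneg (k := 1) hx
    (fun y => ((h.hasDerivAt_V y).const_mul Λ).sub ((h.hasDerivAt_add y).sub (hQ y)))
    (by simp [hQ0, h.P_zero, h.V_zero]) fun y hy _ => by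
      simp only [Pi.sub_apply]
      have : Λ * (P y / Λ) - (V y ^ α - (V y ^ α - Q y)) + 1 * (Λ * V y - (P y + V y - Q y)) =
        (Λ - 1) * V y := by field_simp; ring
      rw [this]
      exact mul_nonneg (by linarith) (h.V_nonneg hy)
  simp only [Pi.sub_apply] at this
  linarith

lemma div_mem_initialInterval (h : IsProfile α Λ V P) (hα : 0 < α) (hΛ : 0 < Λ) {θ Y : ℝ}
    (hY : 0 < Y) (hYθ : Q Y = θ * (P Y + V Y)) :
    V Y / (P Y + V Y) ∈ initialInterval θ Λ := by
  have hW := h.add_pos hY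
  unfold initialInterval
  split_ifs with hΛ1
  · rw [mem_Icc, le_div_iff₀ hW, div_le_iff₀ hW]
    have h1 := h.P_le_transform hQ0 hQ hΛ hΛ1.le hY.le
    have h2 := h.mul_transform_le_P hQ0 hQ hα hΛ hΛ1.le hY.le
    rw [hYθ] at h1 h2
    constructor <;> linarith
  · rw [mem_Icc, le_div_iff₀ hW, div_le_iff₀ hW]
    have h1 := h.transform_div_le_P hQ0 hQ (not_lt.1 hΛ1) hY.le
    have h2 := h.add_sub_transform_le hQ0 hQ (not_lt.1 hΛ1) hY.le
    rw [hYθ] at h1 h2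
    rw [show (1 - θ) / Λ * (P Y + V Y) = ((1 - θ) * (P Y + V Y)) / Λ by ring, div_le_iff₀ hΛ]
    rw [show θ * (P Y + V Y) / Λ = θ / Λ * (P Y + V Y) by ring] at h1
    constructor <;> linarith

end Transform

end IsProfile

lemma initialInterval_subset {θ Λ : ℝ} (hθ0 : 0 < θ) (hθ1 : θ < 1) (hΛ : 0 < Λ) :
    initialInterval θ Λ ⊆ Ioo 0 1 := by
  unfold initialInterval
  have h1 : 0 < 1 - θ := by linarith
  split_ifs with h
  · exact fun x hx => ⟨by linarith [hx.1], by linarith [hx.2, mul_pos hΛ hθ0]⟩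
  · exact fun x hx => ⟨(div_pos h1 hΛ).trans_le hx.1, by linarith [hx.2, div_pos hθ0 hΛ]⟩

/-! ### Desingularization at the free boundary. -/

/-- The desingularized variables `s = V ^ (1 / m)` and `p = V' / s ^ (m - 1)` of a profile. -/
structure IsDesingularization (m Λ : ℝ) (V s p : ℝ → ℝ) : Prop where
  continuousOn_s : ContinuousOn s (Ici 0)
  continuousOn_p : ContinuousOn p (Ici 0)
  s_zero : s 0 = 0
  s_pos : ∀ x, 0 < x → 0 < s x
  p_pos : ∀ x, 0 ≤ x → 0 < p x
  hasDerivAt_s : ∀ x, 0 < x → HasDerivAt s (p x / m) x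
  hasDerivAt_p : ∀ x, 0 < x →
    HasDerivAt p (((1 - s x * p x) / Λ - (m - 1) / m * p x ^ 2) / s x) x
  V_eq : ∀ x, 0 ≤ x → V x = s x ^ m

namespace IsProfile
variable {α Λ : ℝ} {V P : ℝ → ℝ}

/-- Energy inequality: multiplying the equation by 2P shows that the difference of the two sides
grows at the dissipation rate 2P²/Λ. -/
lemma sq_P_le (h : IsProfile α Λ V P) (hα0 : 0 < α) (hΛ : 0 < Λ) {x : ℝ} (hx : 0 ≤ x) :
    P x ^ 2 ≤ 2 * Λ / (1 + α) * V x ^ (1 + α) := by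
  have hd : ∀ y, HasDerivAt (fun y => 2 * Λ / (1 + α) * V y ^ (1 + α) - P y ^ 2)
      (2 * P y ^ 2 / Λ) y := fun y => by
    refine ((((h.hasDerivAt_V y).rpow_const (p := 1 + α) (Or.inr (by linarith))).const_mul
      (2 * Λ / (1 + α))).sub ((h.hasDerivAt_P y).pow 2)).congr_deriv ?_
    rw [show 1 + α - 1 = α by ring]
    field_simp
    push_cast
    ring
  have := nonneg_of_hasDerivAt_add_mul_nonneg (k := 0) hx hd
    (by rw [h.V_zero, h.P_zero, Real.zero_rpow (by linarith)]; simp)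
    fun y hy _ => by rw [zero_mul, add_zero]; positivity
  linarith

/-- Inserting the upper bound for one factor P into the dissipation 2P²/Λ makes it a multiple of V'
V^((1+α)/2), which integrates to V^((3+α)/2). This has higher order than V^(1+α) as V → 0, so the
two bounds give the limit of p at 0. -/
lemma le_sq_P (h : IsProfile α Λ V P) (hα0 : 0 < α) (hΛ : 0 < Λ) :
    ∃ C, ∀ x, 0 ≤ x → 2 * Λ / (1 + α) * V x ^ (1 + α) - C * V x ^ ((3 + α) / 2) ≤ P x ^ 2 := by
  set K := Real.sqrt (2 * Λ / (1 + α)) with hK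
  have hP : ∀ x, 0 ≤ x → P x ≤ K * V x ^ ((1 + α) / 2) := fun x hx => by
    have hV := h.V_nonneg hx
    refine Real.le_sqrt_of_sq_le (h.sq_P_le hα0 hΛ hx) |>.trans_eq ?_
    rw [Real.sqrt_mul (by positivity), ← hK]
    congr 1
    rw [Real.sqrt_eq_rpow, ← Real.rpow_mul hV]; congr 1; ring
  refine ⟨2 * K * (2 / (3 + α)), fun x hx => ?_⟩
  have hd : ∀ y, HasDerivAt (fun y => 2 * K * (2 / (3 + α)) * V y ^ ((3 + α) / 2) -
      (2 * Λ / (1 + α) * V y ^ (1 + α) - P y ^ 2))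
      (2 / Λ * P y * (K * V y ^ ((1 + α) / 2) - P y)) y := fun y => by
    refine ((((h.hasDerivAt_V y).rpow_const (p := (3 + α) / 2) (Or.inr (by linarith))).const_mul
      (2 * K * (2 / (3 + α)))).sub
      ((((h.hasDerivAt_V y).rpow_const (p := 1 + α) (Or.inr (by linarith))).const_mul
      (2 * Λ / (1 + α))).sub ((h.hasDerivAt_P y).pow 2))).congr_deriv ?_
    rw [show 1 + α - 1 = α by ring, show (3 + α) / 2 - 1 = (1 + α) / 2 by ring]
    field_simp
    push_cast
    ring
  have := nonneg_of_hasDerivAt_add_mul_nonneg (k := 0) hx hd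
    (by rw [h.V_zero, h.P_zero, Real.zero_rpow (by linarith), Real.zero_rpow (by linarith)]; simp)
    fun y hy _ => by
      rw [zero_mul, add_zero]
      have h1 := h.P_nonneg hy
      exact mul_nonneg (by positivity) (sub_nonneg.2 (hP y hy))
  linarith

lemma exists_isDesingularization (h : IsProfile α Λ V P) (hα0 : 0 < α) (hα1 : α < 1)
    (hΛ : 0 < Λ) : ∃ s p, IsDesingularization (2 / (1 - α)) Λ V s p := by
  have h1α : 0 < 1 - α := by linarith
  set p₀ := Real.sqrt (2 / (Λ * (1 + α))) with hp₀
  have hp₀0 : 0 < p₀ := by positivity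
  set s : ℝ → ℝ := fun x => V x ^ ((1 - α) / 2) with hs
  -- The quotient is 0/0 at the origin; `p₀` is its limit, found by the two energy bounds.
  set p : ℝ → ℝ := fun x => if x ≤ 0 then p₀ else P x / (Λ * V x ^ ((1 + α) / 2)) with hp
  have hpx : ∀ x, 0 < x → p x = P x / (Λ * V x ^ ((1 + α) / 2)) := fun x hx => by
    simp [hp, not_le.2 hx]
  have hpeq : ∀ x, 0 < x → p =ᶠ[𝓝 x] fun x => P x / (Λ * V x ^ ((1 + α) / 2)) := fun x hx => by
    filter_upwards [lt_mem_nhds hx] with y hy using hpx y hy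
  have hp0 : p 0 = p₀ := by simp [hp]
  have hs_pos : ∀ x, 0 < x → 0 < s x := fun x hx => Real.rpow_pos_of_pos (h.V_pos x hx) _
  have hp_pos : ∀ x, 0 < x → 0 < p x := fun x hx => by
    rw [hpx x hx]
    exact div_pos (h.P_pos hx) (mul_pos hΛ (Real.rpow_pos_of_pos (h.V_pos x hx) _))
  have hds : ∀ x, 0 < x → HasDerivAt s (p x / (2 / (1 - α))) x := fun x hx => by
    have hV := h.V_pos x hx
    refine ((h.hasDerivAt_V x).rpow_const (p := (1 - α) / 2) (Or.inl hV.ne')).congr_deriv ?_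
    rw [hpx x hx, show (1 - α) / 2 - 1 = -((1 + α) / 2) by ring, Real.rpow_neg hV.le]
    field_simp
  have hdp : ∀ x, 0 < x → HasDerivAt p
      (((1 - s x * p x) / Λ - (2 / (1 - α) - 1) / (2 / (1 - α)) * p x ^ 2) / s x) x := fun x hx => by
    have hV := h.V_pos x hx
    refine HasDerivAt.congr_of_eventuallyEq ?_ (hpeq x hx)
    have ha : 0 < V x ^ ((1 + α) / 2) := by positivity
    have hb : 0 < s x := hs_pos x hx
    refine ((h.hasDerivAt_P x).div (((h.hasDerivAt_V x).rpow_const (p := (1 + α) / 2)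
      (Or.inl hV.ne')).const_mul Λ) (by positivity)).congr_deriv ?_
    have e1 : V x ^ α = V x ^ ((1 + α) / 2) / s x := by
      rw [hs]; dsimp only; rw [← Real.rpow_sub hV]; congr 1; ring
    have e2 : V x ^ ((1 + α) / 2 - 1) = 1 / s x := by
      rw [hs]; dsimp only; rw [one_div, ← Real.rpow_neg hV.le]; congr 1; ring
    rw [e2, e1, hpx x hx]
    set a := V x ^ ((1 + α) / 2)
    set b := s x
    field_simp
    ring
  have hscont : Continuous s := h.continuous_V.rpow_const fun x => Or.inr (by positivity)
  have hs0 : s 0 = 0 := by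
    simp only [hs, h.V_zero]; exact Real.zero_rpow (by positivity)
  have hlim : ContinuousWithinAt p (Ici 0) 0 := by
    rw [← continuousWithinAt_Ioi_iff_Ici, ContinuousWithinAt, hp0]
    obtain ⟨C, hC⟩ := h.le_sq_P hα0 hΛ
    have hsq : Tendsto (fun x => p x ^ 2) (𝓝[>] 0) (𝓝 (2 / (Λ * (1 + α)))) := by
      have hlow : Tendsto (fun x => 2 / (Λ * (1 + α)) - C / Λ ^ 2 * s x) (𝓝[>] 0)
          (𝓝 (2 / (Λ * (1 + α)))) := by
        have : Tendsto (fun x => 2 / (Λ * (1 + α)) - C / Λ ^ 2 * s x) (𝓝 0)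
            (𝓝 (2 / (Λ * (1 + α)) - C / Λ ^ 2 * s 0)) :=
          (by fun_prop : Continuous fun x => 2 / (Λ * (1 + α)) - C / Λ ^ 2 * s x).tendsto 0
        rw [hs0, mul_zero, sub_zero] at this
        exact this.mono_left nhdsWithin_le_nhds
      have hsqx : ∀ x, 0 < x → p x ^ 2 = P x ^ 2 / (Λ ^ 2 * V x ^ (1 + α)) := fun x hx => by
        rw [hpx x hx, div_pow, mul_pow, ← Real.rpow_natCast (V x ^ ((1 + α) / 2)),
          ← Real.rpow_mul (h.V_pos x hx).le]
        congr 3; push_cast; ring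
      refine tendsto_of_tendsto_of_tendsto_of_le_of_le' hlow tendsto_const_nhds ?_ ?_
      · filter_upwards [self_mem_nhdsWithin] with x hx
        have hV := h.V_pos x hx
        rw [hsqx x hx, le_div_iff₀ (by positivity)]
        refine le_trans (le_of_eq ?_) (hC x (le_of_lt hx))
        have : V x ^ ((3 + α) / 2) = s x * V x ^ (1 + α) := by
          rw [hs]; dsimp only; rw [← Real.rpow_add hV]; congr 1; ring
        rw [this]
        field_simp
      · filter_upwards [self_mem_nhdsWithin] with x hx
        have hV := h.V_pos x hx
        rw [hsqx x hx, div_le_iff₀ (by positivity)]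
        refine (h.sq_P_le hα0 hΛ (le_of_lt hx)).trans_eq ?_
        field_simp
    refine (hsq.sqrt).congr' ?_
    filter_upwards [self_mem_nhdsWithin] with x hx
    exact Real.sqrt_sq (hp_pos x hx).le
  refine ⟨s, p, hscont.continuousOn, fun x hx => ?_, hs0, hs_pos, fun x hx => ?_, hds, hdp,
    fun x hx => ?_⟩
  · rcases (mem_Ici.1 hx).eq_or_lt with rfl | hx
    · exact hlim
    · exact (hdp x hx).continuousAt.continuousWithinAt
  · rcases hx.eq_or_lt with rfl | hx
    · rwa [hp0]
    · exact hp_pos x hx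
  · rw [hs]; dsimp only
    rw [← Real.rpow_mul (h.V_nonneg hx)]
    nth_rewrite 1 [← Real.rpow_one (V x)]
    congr 1; field_simp

end IsProfile

/-! ### Higher derivatives of the profile. -/

/-- The smooth functions `g k` with `V^{(k)} = s ^ (m - k) * g k (s, p)`. -/
noncomputable def derivCoeff (m Λ : ℝ) : ℕ → ℝ × ℝ → ℝ
  | 0 => fun _ => 1
  | k + 1 => fun z => (m - k) / m * z.2 * derivCoeff m Λ k z +
      fderiv ℝ (derivCoeff m Λ k) z
        (z.1 * z.2 / m, (1 - z.1 * z.2) / Λ - (m - 1) / m * z.2 ^ 2)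

lemma contDiff_derivCoeff (m Λ : ℝ) (k : ℕ) : ContDiff ℝ ∞ (derivCoeff m Λ k) := by
  induction k with
  | zero => exact contDiff_const
  | succ k ih =>
    have h1 : ContDiff ℝ ∞ (fderiv ℝ (derivCoeff m Λ k)) := ih.fderiv_right (by simp)
    unfold derivCoeff
    exact ((contDiff_const.mul contDiff_snd).mul ih).add (h1.clm_apply (by fun_prop))

/-- The `k`-th derivative of `V = s ^ m`. -/
noncomputable def profileDeriv (m Λ : ℝ) (s p : ℝ → ℝ) (k : ℕ) (x : ℝ) : ℝ :=
  s x ^ (m - k) * derivCoeff m Λ k (s x, p x)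

namespace IsDesingularization
variable {m Λ : ℝ} {V s p : ℝ → ℝ}

/-- The field (s s', s p') is polynomial in (s, p), so each differentiation costs exactly one power
of s and leaves a smooth coefficient. -/
lemma hasDerivAt_profileDeriv (h : IsDesingularization m Λ V s p) (k : ℕ) {x : ℝ}
    (hx : 0 < x) :
    HasDerivAt (profileDeriv m Λ s p k) (profileDeriv m Λ s p (k + 1) x) x := by
  have hs := h.s_pos x hx
  have h1 := (h.hasDerivAt_s x hx).rpow_const (p := m - k) (Or.inl hs.ne')
  have h2 := (((contDiff_derivCoeff m Λ k).differentiable (by simp)).differentiableAt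
    (x := (s x, p x))).hasFDerivAt.comp_hasDerivAt x
      ((h.hasDerivAt_s x hx).prodMk (h.hasDerivAt_p x hx))
  refine (h1.mul h2).congr_deriv ?_
  unfold profileDeriv
  rw [derivCoeff]
  have e1 : (p x / m, ((1 - s x * p x) / Λ - (m - 1) / m * p x ^ 2) / s x) =
      (1 / s x) • (s x * p x / m, (1 - s x * p x) / Λ - (m - 1) / m * p x ^ 2) := by
    rw [Prod.smul_mk]; simp only [smul_eq_mul]
    congr 1 <;> field_simp
  have e2 : s x ^ (m - k) = s x ^ (m - k - 1) * s x := by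
    rw [← Real.rpow_add_one hs.ne', sub_add_cancel]
  rw [e1, map_smul, smul_eq_mul, e2, show m - ((k + 1 : ℕ) : ℝ) = m - k - 1 by push_cast; ring]
  simp only [Function.comp]
  field_simp

lemma continuousOn_profileDeriv (h : IsDesingularization m Λ V s p) {k : ℕ} (hk : (k : ℝ) ≤ m) :
    ContinuousOn (profileDeriv m Λ s p k) (Ici 0) :=
  (h.continuousOn_s.rpow_const fun _ _ => Or.inr (by linarith)).mul
    ((contDiff_derivCoeff m Λ k).continuous.comp_continuousOn
      (h.continuousOn_s.prodMk h.continuousOn_p))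

lemma hasDerivWithinAt_profileDeriv (h : IsDesingularization m Λ V s p) {k : ℕ}
    (hk : ((k + 1 : ℕ) : ℝ) ≤ m) {x : ℝ} (hx : 0 ≤ x) :
    HasDerivWithinAt (profileDeriv m Λ s p k) (profileDeriv m Λ s p (k + 1) x) (Ici 0) x := by
  rcases hx.eq_or_lt with rfl | hx
  · have hk' : (k : ℝ) ≤ m := by push_cast at hk; linarith
    refine hasDerivWithinAt_Ici_of_tendsto_deriv (s := Ioi 0)
      (fun x hx => (h.hasDerivAt_profileDeriv k hx).differentiableAt.differentiableWithinAt)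
      ((h.continuousOn_profileDeriv hk' 0 (mem_Ici.2 le_rfl)).mono Ioi_subset_Ici_self)
      self_mem_nhdsWithin ?_
    refine Tendsto.congr' ?_ ((h.continuousOn_profileDeriv hk 0 (mem_Ici.2 le_rfl)).mono
      Ioi_subset_Ici_self)
    filter_upwards [self_mem_nhdsWithin] with x hx
    exact (h.hasDerivAt_profileDeriv k hx).deriv.symm
  · exact (h.hasDerivAt_profileDeriv k hx).hasDerivWithinAt

lemma profileDeriv_zero (h : IsDesingularization m Λ V s p) {x : ℝ} (hx : 0 ≤ x) :
    profileDeriv m Λ s p 0 x = V x := by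
  simp [profileDeriv, derivCoeff, h.V_eq x hx]

/-- s' = p/m, and p has a positive minimum on the compact interval. -/
lemma exists_mul_le_s (h : IsDesingularization m Λ V s p) (hm : 0 < m) {Y : ℝ} (hY : 0 < Y) :
    ∃ κ, 0 < κ ∧ ∀ x, 0 ≤ x → x ≤ Y → κ * x ≤ s x := by
  obtain ⟨x₀, hx₀, hmin⟩ := isCompact_Icc.exists_isMinOn (nonempty_Icc.2 hY.le)
    (h.continuousOn_p.mono Icc_subset_Ici_self)
  refine ⟨p x₀ / m, div_pos (h.p_pos x₀ hx₀.1) hm, fun x hx hxY => ?_⟩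
  have hmono : MonotoneOn (fun x => s x - p x₀ / m * x) (Icc 0 Y) := by
    have hd : ∀ x, 0 < x → HasDerivAt (fun x => s x - p x₀ / m * x) (p x / m - p x₀ / m) x :=
      fun x hx => ((h.hasDerivAt_s x hx).sub ((hasDerivAt_id x).const_mul _)).congr_deriv
        (by ring)
    refine monotoneOn_of_hasDerivWithinAt_nonneg (convex_Icc 0 Y)
      ((h.continuousOn_s.mono Icc_subset_Ici_self).sub (by fun_prop))
      (fun x hx => (hd x ?_).hasDerivWithinAt) fun x hx => ?_
    · rw [interior_Icc] at hx; exact hx.1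
    · rw [interior_Icc] at hx
      have : p x₀ ≤ p x := hmin ⟨hx.1.le, hx.2.le⟩
      rw [sub_nonneg]; gcongr
  have := hmono ⟨le_rfl, hY.le⟩ ⟨hx, hxY⟩ hx
  simp only [h.s_zero, mul_zero, sub_zero] at this
  linarith

end IsDesingularization

/-! ### Families of derivatives and Hölder bounds. -/

/-- `D k`, `k ≤ n`, are the successive derivatives of `D 0` within `S`. -/
def IsDerivFamily (n : ℕ) (S : Set ℝ) (D : ℕ → ℝ → ℝ) : Prop :=
  ∀ k < n, ∀ x ∈ S, HasDerivWithinAt (D k) (D (k + 1) x) S x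

namespace IsDerivFamily
variable {n : ℕ} {S : Set ℝ} {D : ℕ → ℝ → ℝ}

lemma iteratedDerivWithin_eq (h : IsDerivFamily n S D) (hS : UniqueDiffOn ℝ S) {k : ℕ}
    (hk : k ≤ n) : EqOn (iteratedDerivWithin k (D 0) S) (D k) S := by
  induction k with
  | zero => intro x _; simp
  | succ k ih =>
    intro x hx
    rw [iteratedDerivWithin_succ, derivWithin_congr (ih (by omega)) (ih (by omega) hx)]
    exact (h k hk x hx).derivWithin (hS x hx)

lemma contDiffOn (h : IsDerivFamily n S D) (hS : UniqueDiffOn ℝ S) (hc : ContinuousOn (D n) S) :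
    ContDiffOn ℝ n (D 0) S := by
  have key := contDiffOn_of_continuousOn_differentiableOn_deriv (𝕜 := ℝ) (f := D 0) (s := S)
    (n := (n : ℕ∞)) (fun k hk => ?_) fun k hk => ?_
  · exact_mod_cast key
  · have hk : k ≤ n := by exact_mod_cast hk
    refine ContinuousOn.congr ?_ (h.iteratedDerivWithin_eq hS hk)
    rcases hk.eq_or_lt with rfl | hk
    · exact hc
    · exact fun x hx => (h k hk x hx).continuousWithinAt
  · have hk : k < n := by exact_mod_cast hk
    exact DifferentiableOn.congr (fun x hx => (h k hk x hx).differentiableWithinAt)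
      (h.iteratedDerivWithin_eq hS hk.le)

lemma reflect (h : IsDerivFamily n S D) {T : Set ℝ} (a c R : ℝ)
    (hT : MapsTo (fun ξ => c * (R - ξ)) T S) :
    IsDerivFamily n T fun k ξ => a * (-c) ^ k * D k (c * (R - ξ)) := by
  intro k hk ξ hξ
  have h1 : HasDerivWithinAt (fun ξ => c * (R - ξ)) (-c) T ξ :=
    ((((hasDerivAt_id ξ).const_sub R).const_mul c).congr_deriv (by ring)).hasDerivWithinAt
  refine (((h k hk _ (hT hξ)).comp ξ h1 hT).const_mul (a * (-c) ^ k)).congr_deriv ?_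
  dsimp only
  rw [pow_succ]; ring

lemma mono (h : IsDerivFamily n S D) {T : Set ℝ} (hT : T ⊆ S) : IsDerivFamily n T D :=
  fun k hk x hx => (h k hk x (hT hx)).mono hT

end IsDerivFamily

/-- Hölder continuity on `S` in terms of real numbers. -/
def HolderBound (γ : ℝ) (S : Set ℝ) (f : ℝ → ℝ) : Prop :=
  ∃ C, 0 ≤ C ∧ ∀ x ∈ S, ∀ y ∈ S, |f x - f y| ≤ C * |x - y| ^ γ

namespace HolderBound
variable {γ : ℝ} {S : Set ℝ} {f g : ℝ → ℝ}

lemma add (hf : HolderBound γ S f) (hg : HolderBound γ S g) :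
    HolderBound γ S fun x => f x + g x := by
  obtain ⟨C, hC, hf⟩ := hf
  obtain ⟨D, hD, hg⟩ := hg
  refine ⟨C + D, by positivity, fun x hx y hy => ?_⟩
  calc |f x + g x - (f y + g y)| = |(f x - f y) + (g x - g y)| := by ring_nf
    _ ≤ |f x - f y| + |g x - g y| := abs_add_le _ _
    _ ≤ _ := by rw [add_mul]; exact add_le_add (hf x hx y hy) (hg x hx y hy)

lemma const_mul (hf : HolderBound γ S f) (a : ℝ) : HolderBound γ S fun x => a * f x := by
  obtain ⟨C, hC, hf⟩ := hf
  refine ⟨|a| * C, by positivity, fun x hx y hy => ?_⟩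
  rw [← mul_sub, abs_mul, mul_assoc]
  exact mul_le_mul_of_nonneg_left (hf x hx y hy) (abs_nonneg a)

lemma congr (hf : HolderBound γ S f) (h : EqOn g f S) : HolderBound γ S g := by
  obtain ⟨C, hC, hf⟩ := hf
  exact ⟨C, hC, fun x hx y hy => by rw [h hx, h hy]; exact hf x hx y hy⟩

lemma reflect (hf : HolderBound γ S f) {T : Set ℝ} (c R : ℝ)
    (hT : MapsTo (fun ξ => c * (R - ξ)) T S) : HolderBound γ T fun ξ => f (c * (R - ξ)) := by
  obtain ⟨C, hC, hf⟩ := hf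
  refine ⟨C * |c| ^ γ, by positivity, fun x hx y hy => ?_⟩
  refine (hf _ (hT hx) _ (hT hy)).trans_eq ?_
  rw [mul_assoc, ← Real.mul_rpow (abs_nonneg _) (abs_nonneg _), ← abs_mul, ← abs_neg]
  congr 3; ring

lemma holderOnWith (hf : HolderBound γ S f) (hγ : 0 ≤ γ) :
    ∃ C : ℝ≥0, HolderOnWith C γ.toNNReal f S := by
  obtain ⟨C, hC, hf⟩ := hf
  refine ⟨C.toNNReal, fun x hx y hy => ?_⟩
  rw [edist_dist, edist_dist, Real.dist_eq, Real.dist_eq, Real.coe_toNNReal γ hγ,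
    ENNReal.ofReal_rpow_of_nonneg (abs_nonneg _) hγ]
  change _ ≤ ENNReal.ofReal C * _
  rw [← ENNReal.ofReal_mul hC]
  exact ENNReal.ofReal_le_ofReal (hf x hx y hy)

/-- Both (C/γ)x^γ + f and (C/γ)x^γ - f are monotone, and t^γ is subadditive for γ ≤ 1. -/
lemma of_abs_deriv_le {f' : ℝ → ℝ} {Y C : ℝ} (hγ0 : 0 < γ) (hγ1 : γ ≤ 1) (hC : 0 ≤ C)
    (hc : ContinuousOn f (Icc 0 Y)) (hd : ∀ x ∈ Ioo 0 Y, HasDerivAt f (f' x) x)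
    (hb : ∀ x ∈ Ioo 0 Y, |f' x| ≤ C * x ^ (γ - 1)) : HolderBound γ (Icc 0 Y) f := by
  have hpd : ∀ x ∈ Ioo 0 Y, HasDerivAt (fun x => C / γ * x ^ γ) (C * x ^ (γ - 1)) x :=
    fun x hx => ((Real.hasDerivAt_rpow_const (Or.inl hx.1.ne')).const_mul (C / γ)).congr_deriv
      (by field_simp)
  have hpc : ContinuousOn (fun x : ℝ => C / γ * x ^ γ) (Icc 0 Y) :=
    continuousOn_const.mul (continuousOn_id.rpow_const fun _ _ => Or.inr hγ0.le)
  have hadd : MonotoneOn (fun x => C / γ * x ^ γ + f x) (Icc 0 Y) := by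
    refine monotoneOn_of_hasDerivWithinAt_nonneg (convex_Icc 0 Y) (hpc.add hc)
      (f' := fun x => C * x ^ (γ - 1) + f' x) ?_ ?_ <;> rw [interior_Icc] <;> intro x hx
    · exact ((hpd x hx).add (hd x hx)).hasDerivWithinAt
    · linarith [(abs_le.1 (hb x hx)).1]
  have hsub : MonotoneOn (fun x => C / γ * x ^ γ - f x) (Icc 0 Y) := by
    refine monotoneOn_of_hasDerivWithinAt_nonneg (convex_Icc 0 Y) (hpc.sub hc)
      (f' := fun x => C * x ^ (γ - 1) - f' x) ?_ ?_ <;> rw [interior_Icc] <;> intro x hx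
    · exact ((hpd x hx).sub (hd x hx)).hasDerivWithinAt
    · linarith [(abs_le.1 (hb x hx)).2]
  have key : ∀ x ∈ Icc 0 Y, ∀ y ∈ Icc 0 Y, x ≤ y → |f x - f y| ≤ C / γ * |x - y| ^ γ := by
    intro x hx y hy hxy
    have h1 := hadd hx hy hxy
    have h2 := hsub hx hy hxy
    have h3 : y ^ γ ≤ x ^ γ + (y - x) ^ γ := by
      have := Real.rpow_add_le_add_rpow hx.1 (sub_nonneg.2 hxy) hγ0.le hγ1
      rwa [add_sub_cancel] at this
    have h4 : C / γ * y ^ γ ≤ C / γ * x ^ γ + C / γ * (y - x) ^ γ := by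
      rw [← mul_add]; gcongr
    dsimp only at h1 h2
    rw [abs_sub_comm x y, abs_of_nonneg (sub_nonneg.2 hxy), abs_le]
    constructor <;> linarith
  refine ⟨C / γ, by positivity, fun x hx y hy => ?_⟩
  rcases le_total x y with h | h
  · exact key x hx y hy h
  · rw [abs_sub_comm (f x), abs_sub_comm x]; exact key y hy x hx h

lemma of_continuousOn {Y : ℝ} (hc : ContinuousOn f (Icc 0 Y)) : HolderBound 0 (Icc 0 Y) f := by
  obtain ⟨M, hM⟩ := isCompact_Icc.exists_bound_of_continuousOn hc
  refine ⟨2 * |M|, by positivity, fun x hx y hy => ?_⟩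
  rw [Real.rpow_zero, mul_one]
  have h1 := (hM x hx).trans (le_abs_self M)
  have h2 := (hM y hy).trans (le_abs_self M)
  rw [Real.norm_eq_abs] at h1 h2
  linarith [abs_sub (f x) (f y)]

/-- A function with bounded derivative on `[0, Y]` satisfies every Hölder condition of exponent
at most one. -/
lemma of_continuousOn_deriv {f' : ℝ → ℝ} {Y : ℝ} (hγ0 : 0 ≤ γ) (hγ1 : γ < 1)
    (hd : ∀ x ∈ Icc 0 Y, HasDerivWithinAt f (f' x) (Icc 0 Y) x)
    (hc : ContinuousOn f' (Icc 0 Y)) : HolderBound γ (Icc 0 Y) f := by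
  have hfc : ContinuousOn f (Icc 0 Y) := fun x hx => (hd x hx).continuousWithinAt
  rcases hγ0.eq_or_lt with rfl | hγ0
  · exact of_continuousOn hfc
  obtain ⟨M, hM⟩ := isCompact_Icc.exists_bound_of_continuousOn hc
  -- A bounded derivative is also O(x^(γ-1)), since (|Y|/x)^(1-γ) ≥ 1 on the interval.
  refine of_abs_deriv_le (f' := f') (C := |M| * |Y| ^ (1 - γ)) hγ0 hγ1.le (by positivity) hfc
    (fun x hx => (hd x ⟨hx.1.le, hx.2.le⟩).hasDerivAt (Icc_mem_nhds hx.1 hx.2)) fun x hx => ?_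
  have hx0 : 0 < x := hx.1
  have h1 := (hM x ⟨hx.1.le, hx.2.le⟩).trans (le_abs_self M)
  rw [Real.norm_eq_abs] at h1
  have h2 : 1 ≤ |Y| ^ (1 - γ) * x ^ (γ - 1) := by
    rw [show γ - 1 = -(1 - γ) by ring, Real.rpow_neg hx0.le, ← div_eq_mul_inv,
      one_le_div (by positivity)]
    exact Real.rpow_le_rpow hx0.le (hx.2.le.trans (le_abs_self Y)) (by linarith)
  rw [mul_assoc]
  exact h1.trans (le_mul_of_one_le_right (abs_nonneg M) h2)

end HolderBound

namespace IsDesingularization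
variable {m Λ : ℝ} {V s p : ℝ → ℝ}

/-- The last continuous derivative of the profile is Hölder continuous up to the origin. -/
lemma holderBound_profileDeriv (h : IsDesingularization m Λ V s p) (hm : 0 < m) {n : ℕ}
    (hn : (n : ℝ) ≤ m) (hn1 : m < n + 1) {Y : ℝ} (hY : 0 < Y) :
    HolderBound (m - n) (Icc 0 Y) (profileDeriv m Λ s p n) := by
  have hc := (h.continuousOn_profileDeriv hn).mono (Icc_subset_Ici_self : Icc 0 Y ⊆ Ici 0)
  -- For integer m the exponent is 0 and only boundedness is claimed; otherwise the next derivative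
  -- is O(s^(m-n-1)), a negative power, controlled by s ≥ κx.
  rcases hn.eq_or_lt with hn | hn
  · rw [← hn, sub_self]
    exact .of_continuousOn (hn ▸ hc)
  obtain ⟨κ, hκ, hκs⟩ := h.exists_mul_le_s hm hY
  have hgc : ContinuousOn (fun x => derivCoeff m Λ (n + 1) (s x, p x)) (Icc 0 Y) :=
    ((contDiff_derivCoeff m Λ (n + 1)).continuous.comp_continuousOn
      (h.continuousOn_s.prodMk h.continuousOn_p)).mono Icc_subset_Ici_self
  obtain ⟨M, hM⟩ := isCompact_Icc.exists_bound_of_continuousOn hgc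
  refine .of_abs_deriv_le (C := κ ^ (m - n - 1) * |M|) (by linarith) (by linarith)
    (by positivity) hc (fun x hx => h.hasDerivAt_profileDeriv n hx.1) fun x hx => ?_
  have hx0 : 0 < x := hx.1
  have h1 := (hM x ⟨hx.1.le, hx.2.le⟩).trans (le_abs_self M)
  rw [Real.norm_eq_abs] at h1
  have h2 : s x ^ (m - n - 1) ≤ κ ^ (m - n - 1) * x ^ (m - n - 1) := by
    rw [← Real.mul_rpow hκ.le hx0.le]
    exact Real.rpow_le_rpow_of_nonpos (by positivity) (hκs x hx.1.le hx.2.le) (by linarith)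
  have hs := h.s_pos x hx0
  unfold profileDeriv
  rw [abs_mul, abs_of_pos (by positivity),
    show m - ((n + 1 : ℕ) : ℝ) = m - n - 1 by push_cast; ring]
  calc s x ^ (m - n - 1) * _ ≤ (κ ^ (m - n - 1) * x ^ (m - n - 1)) * |M| := by gcongr
    _ = _ := by ring

lemma isDerivFamily_Ioi (h : IsDesingularization m Λ V s p) (n : ℕ) :
    IsDerivFamily n (Ioi 0) (profileDeriv m Λ s p) :=
  fun k _ _ hx => (h.hasDerivAt_profileDeriv k hx).hasDerivWithinAt

lemma isDerivFamily_Ici (h : IsDesingularization m Λ V s p) {n : ℕ} (hn : (n : ℝ) ≤ m) :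
    IsDerivFamily n (Ici 0) (profileDeriv m Λ s p) := fun k hk x hx =>
  h.hasDerivWithinAt_profileDeriv (le_trans (by exact_mod_cast hk) hn) hx

end IsDesingularization

/-! ### Regularity of the temperature. -/

/-- Successive derivatives of a solution `U` of `U' = 1 - U - (Λ D 1 + D 0) / w`. -/
noncomputable def temperatureDeriv (Λ w : ℝ) (D : ℕ → ℝ → ℝ) (U : ℝ → ℝ) : ℕ → ℝ → ℝ
  | 0 => U
  | k + 1 => fun x => (if k = 0 then 1 else 0) - temperatureDeriv Λ w D U k x -
      (Λ * D (k + 1) x + D k x) / w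

/-- Differentiating the equation for U never differentiates V^α, so no derivative is lost. The
constant 1 enters only the first derivative. -/
lemma IsDerivFamily.temperatureDeriv {n : ℕ} {S : Set ℝ} {D : ℕ → ℝ → ℝ} {U : ℝ → ℝ} {Λ w : ℝ}
    (hD : IsDerivFamily n S D)
    (hU : ∀ x ∈ S, HasDerivWithinAt U (1 - U x - (Λ * D 1 x + D 0 x) / w) S x) :
    IsDerivFamily n S (temperatureDeriv Λ w D U) := by
  intro k
  induction k with
  | zero =>
    intro _ x hx
    simpa [_root_.temperatureDeriv] using hU x hx
  | succ k ih =>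
    intro hk x hx
    refine (((ih (by omega) x hx).const_sub (if k = 0 then 1 else 0)).sub
      ((((hD (k + 1) hk x hx).const_mul Λ).add (hD k (by omega) x hx)).div_const w)).congr_deriv ?_
    simp only [_root_.temperatureDeriv, if_neg (Nat.succ_ne_zero k)]
    ring

lemma continuousOn_temperatureDeriv {S : Set ℝ} {D : ℕ → ℝ → ℝ} {U : ℝ → ℝ} {Λ w : ℝ} {n : ℕ}
    (hU : ContinuousOn U S) (hD : ∀ k ≤ n, ContinuousOn (D k) S) :
    ContinuousOn (temperatureDeriv Λ w D U n) S := by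
  induction n with
  | zero => exact hU
  | succ n ih =>
    exact (continuousOn_const.sub (ih fun k hk => hD k (by omega))).sub
      (((continuousOn_const.mul (hD _ le_rfl)).add (hD n (by omega))).div_const w)

/-- In the recursion only `D (n + 1)` is merely Hölder; the other two terms have continuous
derivatives. -/
lemma HolderBound.temperatureDeriv {γ Y : ℝ} {D : ℕ → ℝ → ℝ} {U : ℝ → ℝ} {Λ w : ℝ} {n : ℕ}
    (hγ0 : 0 ≤ γ) (hγ1 : γ < 1) (hD : IsDerivFamily (n + 1) (Icc 0 Y) D)
    (hU : ∀ x ∈ Icc 0 Y, HasDerivWithinAt U (1 - U x - (Λ * D 1 x + D 0 x) / w) (Icc 0 Y) x)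
    (hDc : ∀ k ≤ n + 1, ContinuousOn (D k) (Icc 0 Y))
    (hDn : HolderBound γ (Icc 0 Y) (D (n + 1))) :
    HolderBound γ (Icc 0 Y) (temperatureDeriv Λ w D U (n + 1)) := by
  have hT := hD.temperatureDeriv hU
  have hUc : ContinuousOn U (Icc 0 Y) := fun x hx => (hU x hx).continuousWithinAt
  have h1 : HolderBound γ (Icc 0 Y) (_root_.temperatureDeriv Λ w D U n) :=
    .of_continuousOn_deriv hγ0 hγ1 (hT n (by omega)) (continuousOn_temperatureDeriv hUc hDc)
  have h2 : HolderBound γ (Icc 0 Y) (D n) :=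
    .of_continuousOn_deriv hγ0 hγ1 (hD n (by omega)) (hDc _ le_rfl)
  have h3 : HolderBound γ (Icc 0 Y) fun _ => (if n = 0 then (1:ℝ) else 0) :=
    ⟨0, le_rfl, fun x _ y _ => by simp⟩
  refine ((h3.add (h1.const_mul (-1))).add
    ((hDn.const_mul (-Λ / w)).add (h2.const_mul (-1 / w)))).congr fun x _ => ?_
  simp only [_root_.temperatureDeriv]
  ring

/-- Regularity of a function that is, after reflection and scaling, the start of a family of
successive derivatives. -/
lemma inHolderSpace_reflect {n : ℕ} {γ a c R Y : ℝ} {D : ℕ → ℝ → ℝ} {f : ℝ → ℝ} (hγ : 0 ≤ γ)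
    (hR : 0 < R) (hT : MapsTo (fun ξ => c * (R - ξ)) (Icc 0 R) (Icc 0 Y))
    (hD : IsDerivFamily n (Icc 0 Y) D) (hDc : ContinuousOn (D n) (Icc 0 Y))
    (hDn : HolderBound γ (Icc 0 Y) (D n)) (hf : ∀ ξ ∈ Icc 0 R, f ξ = a * D 0 (c * (R - ξ))) :
    InHolderSpace n γ.toNNReal 0 R f := by
  have hE := hD.reflect a c R hT
  have hS := uniqueDiffOn_Icc hR
  have hf' : EqOn f (fun ξ => a * (-c) ^ 0 * D 0 (c * (R - ξ))) (Icc 0 R) := fun ξ hξ => by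
    dsimp only
    rw [pow_zero, mul_one, hf ξ hξ]
  have hEc : ContinuousOn (fun ξ => a * (-c) ^ n * D n (c * (R - ξ))) (Icc 0 R) :=
    continuousOn_const.mul (hDc.comp (by fun_prop) hT)
  refine ⟨(hE.contDiffOn hS hEc).congr hf', ?_⟩
  refine (((hDn.reflect c R hT).const_mul (a * (-c) ^ n)).congr fun ξ hξ => ?_).holderOnWith hγ
  rw [iteratedDerivWithin_congr hf' hξ]
  exact hE.iteratedDerivWithin_eq hS le_rfl hξ

lemma contDiffOn_infty_reflect {a c R : ℝ} {D : ℕ → ℝ → ℝ} {f : ℝ → ℝ}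
    (hT : MapsTo (fun ξ => c * (R - ξ)) (Ico 0 R) (Ioi 0))
    (hD : ∀ n, IsDerivFamily n (Ioi 0) D)
    (hf : ∀ ξ ∈ Ico 0 R, f ξ = a * D 0 (c * (R - ξ))) : ContDiffOn ℝ ∞ f (Ico 0 R) := by
  refine contDiffOn_infty.2 fun n => ?_
  -- The extra derivative supplies continuity of the n-th one.
  have hE := (hD (n + 1)).reflect a c R hT
  refine ContDiffOn.congr (IsDerivFamily.contDiffOn (fun k hk => hE k (by omega))
    (uniqueDiffOn_Ico 0 R) fun ξ hξ => (hE n (by omega) ξ hξ).continuousWithinAt) fun ξ hξ => ?_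
  rw [pow_zero, mul_one, hf ξ hξ]

lemma hasDerivAt_reflect {f : ℝ → ℝ} {f' c R ξ : ℝ} (hf : HasDerivAt f f' (c * (R - ξ))) :
    HasDerivAt (fun ξ => f (c * (R - ξ))) (-c * f') ξ := by
  have h1 : HasDerivAt (fun ξ => c * (R - ξ)) (-c) ξ :=
    (((hasDerivAt_id ξ).const_sub R).const_mul c).congr_deriv (by ring)
  exact (hf.comp ξ h1).congr_deriv (by ring)

/-! ### Assembling the solution. -/

namespace IsProfile
variable {α Λ θ Y c R : ℝ} {V P Q : ℝ → ℝ}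

/-- The free boundary problem is solved by the rescaled and reflected profile. -/
lemma isOnePhaseSolution (h : IsProfile α Λ V P) (hQ0 : Q 0 = 0)
    (hQ : ∀ x, HasDerivAt Q (V x ^ α - Q x) x) (hΛ : 0 < Λ)
    (hY : 0 < Y) (hYθ : Q Y = θ * (P Y + V Y)) (hc : 0 < c)
    (hcw : c ^ 2 * (P Y + V Y) ^ (α - 1) = 1) (hR : c * R = Y) {u v : ℝ → ℝ}
    (hu : u = fun ξ => 1 - (P (c * (R - ξ)) + V (c * (R - ξ)) - Q (c * (R - ξ))) / (P Y + V Y))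
    (hv : v = fun ξ => 1 / (P Y + V Y) * V (c * (R - ξ)))
    (hv0 : 0 < V Y / (P Y + V Y) ∧ V Y / (P Y + V Y) < 1)
    (hus : ContDiffOn ℝ ∞ u (Ico 0 R)) (hvs : ContDiffOn ℝ ∞ v (Ico 0 R))
    (hu1 : ContDiffOn ℝ 1 u (Icc 0 R)) (hv1 : ContDiffOn ℝ 1 v (Icc 0 R)) :
    IsOnePhaseSolution α θ Λ c R u v := by
  set w := P Y + V Y with hw
  have hw0 : 0 < w := h.add_pos hY
  have hR0 : 0 < R := pos_of_mul_pos_right (hR ▸ hY) hc.le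
  have hdv : ∀ ξ, HasDerivAt v (-(c / (w * Λ)) * P (c * (R - ξ))) ξ := fun ξ => by
    rw [hv]
    exact ((hasDerivAt_reflect (h.hasDerivAt_V (c * (R - ξ)))).const_mul (1 / w)).congr_deriv
      (by field_simp)
  have hdu : ∀ ξ, HasDerivAt u (c / w * Q (c * (R - ξ))) ξ := fun ξ => by
    rw [hu]
    exact ((hasDerivAt_reflect (((h.hasDerivAt_add (c * (R - ξ))).sub
      (hQ (c * (R - ξ)))).div_const w)).const_sub 1).congr_deriv (by ring)
  have hdv' : deriv v = fun ξ => -(c / (w * Λ)) * P (c * (R - ξ)) := funext fun ξ => (hdv ξ).deriv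
  have hdu' : deriv u = fun ξ => c / w * Q (c * (R - ξ)) := funext fun ξ => (hdu ξ).deriv
  -- The normalization of c says w^(-α) = c²/w, which matches the nonlinear term to the factor c²
  -- from two differentiations.
  have hpow : ∀ ξ ∈ Ioo 0 R, v ξ ^ α = c ^ 2 / w * V (c * (R - ξ)) ^ α := fun ξ hξ => by
    have hV : 0 ≤ V (c * (R - ξ)) := h.V_nonneg (mul_nonneg hc.le (sub_nonneg.2 hξ.2.le))
    rw [hv]; dsimp only
    rw [Real.mul_rpow (by positivity) hV, Real.div_rpow zero_le_one hw0.le, Real.one_rpow]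
    congr 1
    rw [Real.rpow_sub_one hw0.ne'] at hcw
    have : 0 < w ^ α := by positivity
    field_simp at hcw ⊢
    linarith
  have hz : c * (R - 0) = Y := by rw [sub_zero, hR]
  have he : c * (R - R) = 0 := by rw [sub_self, mul_zero]
  have hvz : v 0 = V Y / w := by rw [hv]; dsimp only; rw [hz]; ring
  refine ⟨hc, hR0, hus, hvs, hu1, hv1, fun ξ hξ => ?_, fun ξ hξ => ?_, fun ξ hξ => ?_, ?_, ?_,
    hvz ▸ hv0, ?_, ?_, ?_, ?_, ?_⟩
  · rw [hv]
    exact mul_pos (by positivity) (h.V_pos _ (mul_pos hc (sub_pos.2 hξ.2)))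
  · rw [hpow ξ hξ, hdu', ((hasDerivAt_reflect (hQ (c * (R - ξ)))).const_mul (c / w)).deriv]
    ring
  · rw [hpow ξ hξ, hdv',
      ((hasDerivAt_reflect (h.hasDerivAt_P (c * (R - ξ)))).const_mul (-(c / (w * Λ)))).deriv]
    field_simp
    ring
  -- This condition and the next are both the matching equation Q(Y) = θw.
  · rw [hu]; dsimp only
    rw [hz, hYθ, ← hw]; field_simp; ring
  · refine (hdu 0).hasDerivWithinAt.congr_deriv ?_
    rw [hz, hYθ]; field_simp
  · refine (hdv 0).hasDerivWithinAt.congr_deriv ?_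
    rw [hz, hvz, show P Y = w - V Y by rw [hw]; ring]; field_simp
  · rw [hv]; dsimp only; rw [he, h.V_zero, mul_zero]
  · refine (hdv R).hasDerivWithinAt.congr_deriv ?_
    rw [he, h.P_zero, mul_zero]
  · rw [hu]; dsimp only; rw [he, h.V_zero, h.P_zero, hQ0]; simp
  · refine (hdu R).hasDerivWithinAt.congr_deriv ?_
    rw [he, hQ0, mul_zero]

end IsProfile

theorem mainTheorem4 (α θ Λ β : ℝ) (hα0 : 0 < α) (hα1 : α < 1) (hθ0 : 0 < θ) (hθ1 : θ < 1)
    (hΛ : 0 < Λ) (hβ : β = 2 * α / (1 - α)) :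
    initialInterval θ Λ ⊆ Ioo 0 1 ∧
    ∃ (c R : ℝ) (u v : ℝ → ℝ),
      0 < c ∧ 0 < R ∧
      IsOnePhaseSolution α θ Λ c R u v ∧
      v 0 ∈ initialInterval θ Λ ∧
      ContDiffOn ℝ ∞ u (Ico 0 R) ∧
      ContDiffOn ℝ ∞ v (Ico 0 R) ∧
      InHolderSpace (2 + ⌊β⌋₊) (β - ⌊β⌋₊).toNNReal 0 R u ∧
      InHolderSpace (2 + ⌊β⌋₊) (β - ⌊β⌋₊).toNNReal 0 R v := by
  have hsub := initialInterval_subset hθ0 hθ1 hΛ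
  refine ⟨hsub, ?_⟩
  have h1α : 0 < 1 - α := by linarith
  obtain ⟨V, P, h⟩ := exists_isProfile hα0 hα1 hΛ
  obtain ⟨Q, hQ0, hQ⟩ := exists_linear_solution
    (h.continuous_V.rpow_const fun _ => Or.inr hα0.le : Continuous fun x => V x ^ α)
  obtain ⟨Y, hY, hYθ⟩ := h.exists_matching hQ0 hQ hΛ hα0 hα1 hθ0 hθ1
  obtain ⟨s, p, hsp⟩ := h.exists_isDesingularization hα0 hα1 hΛ
  have hmem := h.div_mem_initialInterval hQ0 hQ hα0 hΛ hY hYθ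
  set m := 2 / (1 - α) with hm
  have hmβ : m = 2 + β := by rw [hm, hβ]; field_simp; ring
  have hβ0 : 0 ≤ β := by rw [hβ]; positivity
  have hγ0 : 0 ≤ β - ⌊β⌋₊ := sub_nonneg.2 (Nat.floor_le hβ0)
  have hγ1 : β - ⌊β⌋₊ < 1 := by linarith [Nat.lt_floor_add_one β]
  have hnm : ((2 + ⌊β⌋₊ : ℕ) : ℝ) ≤ m := by push_cast; linarith
  have hγ : m - ((2 + ⌊β⌋₊ : ℕ) : ℝ) = β - ⌊β⌋₊ := by push_cast; linarith
  set w := P Y + V Y with hw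
  have hw0 : 0 < w := h.add_pos hY
  -- The positive root of c² w^(α-1) = 1.
  set c := w ^ ((1 - α) / 2) with hc
  have hc0 : 0 < c := by positivity
  have hcw : c ^ 2 * w ^ (α - 1) = 1 := by
    rw [hc, ← Real.rpow_natCast, ← Real.rpow_mul hw0.le, ← Real.rpow_add hw0]
    rw [show (1 - α) / 2 * ((2 : ℕ) : ℝ) + (α - 1) = 0 by push_cast; ring, Real.rpow_zero]
  set R := Y / c with hRdef
  have hR : c * R = Y := by rw [hRdef]; field_simp
  have hR0 : 0 < R := by positivity
  set D := profileDeriv m Λ s p with hD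
  set U : ℝ → ℝ := fun x => 1 - (P x + V x - Q x) / w with hUdef
  have hD0 : ∀ x, 0 ≤ x → D 0 x = V x := fun x hx => hsp.profileDeriv_zero hx
  have hD1 : ∀ x, 0 ≤ x → D 1 x = P x / Λ := fun x hx => by
    have h1 : HasDerivWithinAt (D 0) (D 1 x) (Ici 0) x :=
      hsp.hasDerivWithinAt_profileDeriv (by push_cast; linarith) hx
    have h2 : HasDerivWithinAt (D 0) (P x / Λ) (Ici 0) x :=
      (h.hasDerivAt_V x).hasDerivWithinAt.congr (fun y hy => hD0 y hy) (hD0 x hx)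
    exact (uniqueDiffOn_Ici 0 x hx).eq_deriv _ h1 h2
  have hU : ∀ x, 0 ≤ x → HasDerivAt U (1 - U x - (Λ * D 1 x + D 0 x) / w) x := fun x hx => by
    refine ((((h.hasDerivAt_add x).sub (hQ x)).div_const w).const_sub 1).congr_deriv ?_
    rw [hD0 x hx, hD1 x hx, hUdef]
    field_simp
    ring
  have hTc : MapsTo (fun ξ => c * (R - ξ)) (Icc 0 R) (Icc 0 Y) := fun ξ hξ =>
    ⟨mul_nonneg hc0.le (sub_nonneg.2 hξ.2), by
      rw [← hR]; exact mul_le_mul_of_nonneg_left (by linarith [hξ.1]) hc0.le⟩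
  have hTo : MapsTo (fun ξ => c * (R - ξ)) (Ico 0 R) (Ioi 0) := fun ξ hξ =>
    mul_pos hc0 (sub_pos.2 hξ.2)
  set u : ℝ → ℝ := fun ξ => U (c * (R - ξ)) with hu
  set v : ℝ → ℝ := fun ξ => 1 / w * V (c * (R - ξ)) with hv
  have hDI : ∀ n, IsDerivFamily n (Ioi 0) D := hsp.isDerivFamily_Ioi
  have hDY : IsDerivFamily (2 + ⌊β⌋₊) (Icc 0 Y) D :=
    (hsp.isDerivFamily_Ici hnm).mono Icc_subset_Ici_self
  have hDc : ∀ k ≤ 2 + ⌊β⌋₊, ContinuousOn (D k) (Icc 0 Y) := fun k hk =>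
    (hsp.continuousOn_profileDeriv (le_trans (by exact_mod_cast hk) hnm)).mono Icc_subset_Ici_self
  have hDn : HolderBound (β - ⌊β⌋₊) (Icc 0 Y) (D (2 + ⌊β⌋₊)) :=
    hγ ▸ hsp.holderBound_profileDeriv (by positivity) hnm (by push_cast; linarith) hY
  have hUY : ∀ x ∈ Icc 0 Y,
      HasDerivWithinAt U (1 - U x - (Λ * D 1 x + D 0 x) / w) (Icc 0 Y) x :=
    fun x hx => (hU x hx.1).hasDerivWithinAt
  have hvs : ContDiffOn ℝ ∞ v (Ico 0 R) := contDiffOn_infty_reflect (a := 1 / w) hTo hDI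
    fun ξ hξ => by rw [hD0 _ (le_of_lt (hTo hξ))]
  have hus : ContDiffOn ℝ ∞ u (Ico 0 R) := contDiffOn_infty_reflect (a := 1) hTo
    (fun n => (hDI n).temperatureDeriv fun x hx => (hU x (le_of_lt hx)).hasDerivWithinAt)
    fun ξ _ => (one_mul _).symm
  have hvH : InHolderSpace (2 + ⌊β⌋₊) (β - ⌊β⌋₊).toNNReal 0 R v :=
    inHolderSpace_reflect (a := 1 / w) hγ0 hR0 hTc hDY (hDc _ le_rfl) hDn
      fun ξ hξ => by rw [hD0 _ (hTc hξ).1]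
  have huH : InHolderSpace (2 + ⌊β⌋₊) (β - ⌊β⌋₊).toNNReal 0 R u := by
    refine inHolderSpace_reflect (a := 1) hγ0 hR0 hTc (hDY.temperatureDeriv hUY)
      (continuousOn_temperatureDeriv (fun x hx => (hUY x hx).continuousWithinAt) hDc) ?_
      fun ξ _ => (one_mul _).symm
    rw [show 2 + ⌊β⌋₊ = (1 + ⌊β⌋₊) + 1 by ring] at hDY hDc hDn ⊢
    exact HolderBound.temperatureDeriv hγ0 hγ1 hDY hUY hDc hDn
  have h1n : (1 : WithTop ℕ∞) ≤ ((2 + ⌊β⌋₊ : ℕ) : WithTop ℕ∞) := by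
    exact_mod_cast (by omega : 1 ≤ 2 + ⌊β⌋₊)
  refine ⟨c, R, u, v, hc0, hR0, ?_, ?_, hus, hvs, huH, hvH⟩
  · exact h.isOnePhaseSolution hQ0 hQ hΛ hY hYθ hc0 hcw hR rfl rfl (hsub hmem) hus hvs
      (huH.1.of_le h1n) (hvH.1.of_le h1n)
  · have : v 0 = V Y / w := by rw [hv]; dsimp only; rw [sub_zero, hR]; ring
    rwa [this]
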